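/- **Long-time convergence for the Fokker–Planck equation with weak confinement.** Let $d\ge 1$, $V(x)=\log(1+|x|^{2d})$ on $\mathbb R^d$. Let $\mathcal P(\mathbb R^d)$ be the Borel probability measures and $\mathcal P_2(\mathbb R^d)$ those with finite second moment, with the Wasserstein distance $W_2$. On $\mathcal P_2(\mathbb R^d)$ consider $$E_{FP}(\rho)=\int_{\mathbb R^d}\rho\log\rho\,dx+\int_{\mathbb R^d}\log(1+|x|^{2d})\,d\rho(x),\qquad G_{FP}(\rho)=\Big(\int_{\mathbb R^d}\big|\nabla\log\big(\rho(1+|x|^{2d})\big)\big|^2d\rho(x)\Big)^{1/2},$$ with $E_{FP}(\rho)=+\infty$ if $\rho$ is not absolutely continuous with respect to Lebesgue measure. Here, with $h=\rho(1+|x|^{2d})$, the vector field $w=\nabla\log h$ is the element of $L^2(\rho;\mathbb R^d)$ for which $\nabla h=h\,w$ in the sense of distributions, and $G_{FP}(\rho)=+\infty$ if $\rho$ is not absolutely continuous or no such $w$ exists. Let $\tilde E_{FP}(\rho)=\int\log\big(\rho(1+|x|^{2d})\big)\,d\rho$ (again $+\infty$ if $\rho$ is not absolutely continuous) and $\tilde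 G_{FP}$, given by the same formula as $G_{FP}$, be defined on all of $\mathcal P(\mathbb R^d)$. A 2-curve of maximal slope is a curve $\rho\in AC([0,\infty);\mathcal P_2(\mathbb R^d))$ such that $E_{FP}\circ\rho$ is a.e. equal to a non-increasing $\varphi:[0,\infty)\to\mathbb R$ with $\varphi'(t)=-\tfrac12|\rho'|^2(t)-\tfrac12G_{FP}^2(\rho(t))$ for a.e. $t\ge0$, where $|\rho'|(t)=\lim_{s\to t}W_2(\rho(t),\rho(s))/|t-s|$. Here $\rho\in AC([0,\infty);\mathcal P_2(\mathbb R^d))$ means that for every $T>0$ there is $m\in L^1([0,T])$ with $W_2(\rho(t),\rho(s))\le\int_s^t m(r)\,dr$ for all $0\le s<t\le T$. A measure $\mu\in\mathcal P(\mathbb R^d)$ is a weak stationary state if $\tilde E_{FP}(\mu)<\infty$ and $\tilde G_{FP}(\mu)=0$. Put $$\rho_\infty(dx)=\frac{Z_\infty}{1+|x|^{2d}}\,dx,\qquad Z_\infty=\Big(\int_{\mathbb R^d}\frac{dx}{1+|x|^{2d}}\Big)^{-1}.$$ Then: 1. $\tilde E_{FP}=E_{FP}$ and $\tilde G_{FP}=G_{FP}$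 on $\mathcal P_2(\mathbb R^d)$. 2. Every 2-curve of maximal slope $\rho$ of $E_{FP}$ with respect to $G_{FP}$ with $E_{FP}(\rho(0))<\infty$ converges narrowly to $\rho_\infty$ as $t\to\infty$; that is, $\lim_{t\to\infty}d_{LP}(\rho(t),\rho_\infty)=0$, where $d_{LP}$ is the Lévy–Prokhorov metric. 3. $\rho_\infty$ is a weak stationary state, and it is the only one in $\mathcal P(\mathbb R^d)$. 4. The second moment of $\rho_\infty$ is infinite if and only if $d\le 2$; thus $\rho_\infty\in\mathcal P(\mathbb R^d)\setminus\mathcal P_2(\mathbb R^d)$ exactly for $d\in\{1,2\}$. -/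

import Mathlib

open MeasureTheory Filter Topology Set
open scoped ENNReal ContDiff

/-- The Euclidean space `ℝᵈ`. -/
abbrev Rd (d : ℕ) : Type := EuclideanSpace ℝ (Fin d)

/-- The space `𝒫(ℝᵈ)` of Borel probability measures. -/
abbrev PAll (d : ℕ) : Type := ProbabilityMeasure (Rd d)

/-- The second moment `∫ |x|² dμ(x)`, with values in `[0, ∞]`. -/
noncomputable def secondMoment {d : ℕ} (μ : PAll d) : ℝ≥0∞ :=
  ∫⁻ x, ‖x‖ₑ ^ 2 ∂(μ : Measure (Rd d))

/-- The space `𝒫₂(ℝᵈ)` of Borel probability measures with finite second moment. -/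
abbrev P2 (d : ℕ) : Type := {μ : PAll d // secondMoment μ < ⊤}

/-- The quadratic Wasserstein distance `W₂`: the square root of the infimum of
`∫ |x - y|² dπ(x, y)` over all couplings `π` of `μ` and `ν`.
It is finite on `𝒫₂(ℝᵈ)`, so that no information is lost in passing to `ℝ`. -/
noncomputable def W2 {d : ℕ} (μ ν : P2 d) : ℝ :=
  ((⨅ (π : Measure (Rd d × Rd d))
      (_ : π.map Prod.fst = (μ.1 : Measure (Rd d)) ∧ π.map Prod.snd = (ν.1 : Measure (Rd d))),
      ∫⁻ z, edist z.1 z.2 ^ 2 ∂π) ^ (1 / 2 : ℝ)).toReal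

/-- `ρ ∈ AC([0, ∞); 𝒫₂(ℝᵈ))`: for each `T > 0` there is `m ∈ L¹([0, T])` with
`W₂(ρ(t), ρ(s)) ≤ ∫ₛᵗ m(r) dr` for all `0 ≤ s < t ≤ T` (which implies continuity).
Only the values of `ρ` at times `t ≥ 0` matter. -/
def IsACCurve {d : ℕ} (ρ : ℝ → P2 d) : Prop :=
  ∀ T : ℝ, 0 < T → ∃ m : ℝ → ℝ, IntegrableOn m (Icc 0 T) ∧
    ∀ s t : ℝ, 0 ≤ s → s < t → t ≤ T → W2 (ρ t) (ρ s) ≤ ∫ r in s..t, m r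

/-- The metric derivative `|ρ'|(t) = lim_{s → t} W₂(ρ(t), ρ(s)) / |t - s|` exists and equals `v`. -/
def HasMetricDerivAt {d : ℕ} (ρ : ℝ → P2 d) (v : ℝ) (t : ℝ) : Prop :=
  Tendsto (fun s : ℝ => W2 (ρ t) (ρ s) / |t - s|) (𝓝[≠] t) (𝓝 v)

/-- `ρ` is a 2-curve of maximal slope for the functional `E` with respect to `G`: it is absolutely
continuous, `E ∘ ρ` is a.e. equal to a non-increasing map `φ` on `[0, ∞)`, and
`φ'(t) = - |ρ'|²(t) / 2 - G(ρ(t))² / 2` for a.e. `t ≥ 0`. -/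
def IsCurveOfMaximalSlope {d : ℕ} (E : P2 d → EReal) (G : P2 d → ℝ≥0∞) (ρ : ℝ → P2 d) : Prop :=
  IsACCurve ρ ∧
    ∃ φ : ℝ → ℝ, AntitoneOn φ (Ici 0) ∧
      (∀ᵐ t ∂(volume.restrict (Ici (0 : ℝ))), E (ρ t) = (φ t : EReal)) ∧
      ∀ᵐ t ∂(volume.restrict (Ici (0 : ℝ))), ∃ v : ℝ, HasMetricDerivAt ρ v t ∧ G (ρ t) ≠ ⊤ ∧
        HasDerivAt φ (-(1 / 2) * v ^ 2 - (1 / 2) * (G (ρ t)).toReal ^ 2) t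

/-- `μ` is a weak stationary state for the extensions `E'`, `G'` to `𝒫(ℝᵈ)` of the energy and
of its weak upper gradient. -/
def IsWeakStationaryState {d : ℕ} (E' : PAll d → EReal) (G' : PAll d → ℝ≥0∞) (μ : PAll d) :
    Prop :=
  E' μ < ⊤ ∧ G' μ = 0

/-- The integral of a real function with values in `[-∞, ∞]`, positive part minus negative part.
It is only used where at least one of the two parts is finite. -/
noncomputable def extIntegral {d : ℕ} (ν : Measure (Rd d)) (f : Rd d → ℝ) : EReal :=
  ((∫⁻ x, ENNReal.ofReal (f x) ∂ν : ℝ≥0∞) : EReal) -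
    ((∫⁻ x, ENNReal.ofReal (-f x) ∂ν : ℝ≥0∞) : EReal)

/-- The confinement potential `V(x) = log (1 + |x|^{2d})`. -/
noncomputable def potV {d : ℕ} (x : Rd d) : ℝ := Real.log (1 + ‖x‖ ^ (2 * d))

/-- The Lebesgue density of (the absolutely continuous part of) `μ`. -/
noncomputable def dens {d : ℕ} (μ : PAll d) (x : Rd d) : ℝ :=
  ((μ : Measure (Rd d)).rnDeriv volume x).toReal

/-- The function `ρ(x) (1 + |x|^{2d})`, where `ρ` is the Lebesgue density of `μ`. -/
noncomputable def weightedDens {d : ℕ} (μ : PAll d) (x : Rd d) : ℝ :=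
  dens μ x * (1 + ‖x‖ ^ (2 * d))

open Classical in
/-- The free energy `E_FP(ρ) = ∫ ρ log ρ dx + ∫ log (1 + |x|^{2d}) dρ` on `𝒫₂(ℝᵈ)`,
`+∞` if `ρ` has no Lebesgue density. -/
noncomputable def EFP {d : ℕ} (μ : P2 d) : EReal :=
  if (μ.1 : Measure (Rd d)) ≪ volume then
    extIntegral volume (fun x => dens μ.1 x * Real.log (dens μ.1 x)) +
      extIntegral (μ.1 : Measure (Rd d)) potV
  else ⊤

open Classical in
/-- The extension of the free energy to `𝒫(ℝᵈ)`. As both integrals in the definition of `E_FP` may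
be infinite with opposite signs there, they are taken together: the extended energy is
`∫ log (ρ (1 + |x|^{2d})) dρ`, the relative entropy with respect to `dx / (1 + |x|^{2d})`. -/
noncomputable def EFPext {d : ℕ} (μ : PAll d) : EReal :=
  if (μ : Measure (Rd d)) ≪ volume then
    extIntegral (μ : Measure (Rd d)) (fun x => Real.log (weightedDens μ x))
  else ⊤

/-- `w` is the logarithmic gradient `∇ log (ρ (1 + |x|^{2d}))` of `μ = ρ dx`, and lies in
`L²(μ; ℝᵈ)`: with `h = ρ (1 + |x|^{2d})`, the distributional gradient of `h` is `h w`.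
These conditions determine `w` up to `μ`-null sets. -/
def IsLogGradient {d : ℕ} (μ : PAll d) (w : Rd d → Rd d) : Prop :=
  (μ : Measure (Rd d)) ≪ volume ∧ MemLp w 2 (μ : Measure (Rd d)) ∧
    ∀ ψ : Rd d → ℝ, ContDiff ℝ ∞ ψ → HasCompactSupport ψ → ∀ e : Rd d,
      ∫ x, weightedDens μ x * fderiv ℝ ψ x e = -∫ x, weightedDens μ x * inner ℝ (w x) e * ψ x

/-- The extended weak upper gradient on `𝒫(ℝᵈ)`,
`(∫ |∇ log (ρ (1 + |x|^{2d}))|² dρ)^{1/2}`, equal to `+∞` when `ρ` has no Lebesgue density or no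
logarithmic gradient in `L²(ρ)`. (The infimum is over functions which agree `μ`-a.e.) -/
noncomputable def GFPext {d : ℕ} (μ : PAll d) : ℝ≥0∞ :=
  ⨅ (w : Rd d → Rd d) (_ : IsLogGradient μ w),
    (∫⁻ x, ‖w x‖ₑ ^ 2 ∂(μ : Measure (Rd d))) ^ (1 / 2 : ℝ)

/-- The weak upper gradient `G_FP` on `𝒫₂(ℝᵈ)`, given by the same formula. -/
noncomputable def GFP {d : ℕ} (μ : P2 d) : ℝ≥0∞ := GFPext μ.1

/-- `Z_∞ = (∫ dx / (1 + |x|^{2d}))⁻¹`. -/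
noncomputable def Zinf (d : ℕ) : ℝ := (∫ x : Rd d, 1 / (1 + ‖x‖ ^ (2 * d)))⁻¹

/-- The measure `Z_∞ / (1 + |x|^{2d}) dx`. -/
noncomputable def rhoInfMeasure (d : ℕ) : Measure (Rd d) :=
  volume.withDensity (fun x => ENNReal.ofReal (Zinf d / (1 + ‖x‖ ^ (2 * d))))

lemma integrable_weight (d : ℕ) : Integrable (fun x : Rd d => 1 / (1 + ‖x‖ ^ (2 * d))) := by
  have hcont : Continuous (fun x : Rd d => 1 / (1 + ‖x‖ ^ (2 * d))) := by
    refine continuous_const.div (by fun_prop) (fun x => ?_)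
    positivity
  rcases Nat.eq_zero_or_pos d with rfl | hd
  · exact hcont.integrable_of_hasCompactSupport (HasCompactSupport.of_compactSpace _)
  · have h1 : Integrable (fun x : Rd d => (2 : ℝ) ^ d * (1 + ‖x‖ ^ 2) ^ (-(2 * d : ℝ) / 2)) := by
      refine (integrable_rpow_neg_one_add_norm_sq (r := 2 * d) ?_).const_mul _
      have : (0 : ℝ) < d := by exact_mod_cast hd
      simp only [finrank_euclideanSpace, Fintype.card_fin]
      linarith
    refine h1.mono' hcont.aestronglyMeasurable (Eventually.of_forall fun x => ?_)
    have hb : (0 : ℝ) < 1 + ‖x‖ ^ 2 := by positivity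
    have h2 : (1 + ‖x‖ ^ 2) ^ (-(2 * d : ℝ) / 2) = ((1 + ‖x‖ ^ 2) ^ d)⁻¹ := by
      rw [show (-(2 * d : ℝ) / 2) = -(d : ℝ) by ring, Real.rpow_neg hb.le, Real.rpow_natCast]
    have h3 : (1 + ‖x‖ ^ 2) ^ d ≤ (2 : ℝ) ^ d * (1 + ‖x‖ ^ (2 * d)) := by
      have h4 : (1 + ‖x‖ ^ 2) ^ d ≤ 2 ^ (d - 1) * (1 ^ d + (‖x‖ ^ 2) ^ d) :=
        add_pow_le zero_le_one (by positivity) d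
      rw [one_pow, ← pow_mul] at h4
      refine h4.trans ?_
      gcongr
      · norm_num
      · omega
    rw [Real.norm_of_nonneg (by positivity), h2, ← div_eq_mul_inv,
      div_le_div_iff₀ (by positivity) (by positivity), one_mul]
    exact h3

lemma integral_weight_pos (d : ℕ) : 0 < ∫ x : Rd d, 1 / (1 + ‖x‖ ^ (2 * d)) := by
  rw [integral_pos_iff_support_of_nonneg (fun x => by positivity) (integrable_weight d)]
  have : Function.support (fun x : Rd d => 1 / (1 + ‖x‖ ^ (2 * d))) = univ := by
    ext x
    simp only [Function.mem_support, mem_univ, iff_true]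
    positivity
  rw [this]
  exact Measure.measure_univ_pos.2 (NeZero.ne _)

instance isProbabilityMeasure_rhoInfMeasure (d : ℕ) : IsProbabilityMeasure (rhoInfMeasure d) := by
  constructor
  have hpos := integral_weight_pos d
  have hf : (fun x : Rd d => Zinf d / (1 + ‖x‖ ^ (2 * d))) =
      fun x => Zinf d * (1 / (1 + ‖x‖ ^ (2 * d))) := by
    ext x; ring
  have hZ : 0 < Zinf d := inv_pos.2 hpos
  rw [rhoInfMeasure, withDensity_apply _ MeasurableSet.univ, Measure.restrict_univ,
    ← ofReal_integral_eq_lintegral_ofReal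
      (by rw [hf]; exact (integrable_weight d).const_mul _)
      (Eventually.of_forall fun x => by positivity),
    hf, integral_const_mul, Zinf, inv_mul_cancel₀ hpos.ne', ENNReal.ofReal_one]

/-- The probability measure `ρ_∞(dx) = Z_∞ / (1 + |x|^{2d}) dx`. -/
noncomputable def rhoInf (d : ℕ) : PAll d := ⟨rhoInfMeasure d, inferInstance⟩

/-! Relative to the finite measure dx/(1+|x|^{2d}), the energy is a relative entropy. It is
therefore bounded below, and its sublevel sets are tight even though second moments may be lost in
the limit (`neg_invWeightMeasure_le_EFPext`, `isTightMeasureSet_EFPext_le`).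

Lower semicontinuity of the slope is not needed. Integrating by parts against a test function gives
|∫ (1+|x|^{2d}) ∂_e ψ dμ| ≤ C · slope(μ), with C independent of μ
(`exists_integral_fderiv_le_GFPext`), and the left side is narrowly continuous in μ. If the slope
vanishes, or tends to zero along measures converging to μ, all these integrals vanish. Then
(1+|x|^{2d}) μ is translation invariant, hence a multiple of Lebesgue measure, and μ = ρ_∞. This
gives both uniqueness and the identification of limits.

Along a curve of maximal slope, φ decreases and is bounded below, so its drop over [s, s+1] tends to
zero. The drop controls half the integrals of the squared slope and of the squared speed. Hence some
time T(s) in [s, s+1] has small slope, so ρ(T(s)) → ρ_∞, while ∫ f dρ(s) and ∫ f dρ(T(s)) become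
close for every bounded Lipschitz f. -/

variable {d : ℕ}

/-! ### The energy and its extension agree on 𝒫₂ -/

lemma one_add_norm_pow_pos (x : Rd d) : 0 < 1 + ‖x‖ ^ (2 * d) := by positivity

lemma continuous_weight : Continuous fun x : Rd d => 1 + ‖x‖ ^ (2 * d) := by fun_prop

lemma measurable_dens (μ : PAll d) : Measurable (dens μ) :=
  (Measure.measurable_rnDeriv _ _).ennreal_toReal

lemma dens_nonneg (μ : PAll d) (x : Rd d) : 0 ≤ dens μ x := ENNReal.toReal_nonneg

lemma measurable_weightedDens (μ : PAll d) : Measurable (weightedDens μ) :=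
  (measurable_dens μ).mul continuous_weight.measurable

lemma weightedDens_nonneg (μ : PAll d) (x : Rd d) : 0 ≤ weightedDens μ x :=
  mul_nonneg (dens_nonneg μ x) (one_add_norm_pow_pos x).le

lemma continuous_potV : Continuous (potV : Rd d → ℝ) :=
  continuous_weight.log fun x => (one_add_norm_pow_pos x).ne'

lemma potV_nonneg (x : Rd d) : 0 ≤ potV x :=
  Real.log_nonneg (le_add_of_nonneg_right (by positivity))

/-- The quadratic bound makes V integrable against every measure in 𝒫₂, which is what lets the
energy be split into entropy and potential. -/
lemma potV_le (x : Rd d) : potV x ≤ Real.log 2 + d * ‖x‖ ^ 2 := by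
  have h1 : 1 + ‖x‖ ^ (2 * d) ≤ 2 * (1 + ‖x‖ ^ 2) ^ d := by
    have h2 : (1 : ℝ) ≤ (1 + ‖x‖ ^ 2) ^ d := one_le_pow₀ (le_add_of_nonneg_right (by positivity))
    have h3 : ‖x‖ ^ (2 * d) ≤ (1 + ‖x‖ ^ 2) ^ d := by
      rw [pow_mul]
      gcongr
      linarith
    linarith
  have h4 : Real.log (1 + ‖x‖ ^ 2) ≤ ‖x‖ ^ 2 := by
    have := Real.log_le_sub_one_of_pos (x := 1 + ‖x‖ ^ 2) (by positivity)
    linarith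
  calc potV x ≤ Real.log (2 * (1 + ‖x‖ ^ 2) ^ d) :=
        Real.log_le_log (one_add_norm_pow_pos x) h1
    _ = Real.log 2 + d * Real.log (1 + ‖x‖ ^ 2) := by
        rw [Real.log_mul two_ne_zero (by positivity), Real.log_pow]
    _ ≤ _ := by gcongr

lemma integrable_norm_sq (μ : P2 d) :
    Integrable (fun x : Rd d => ‖x‖ ^ 2) (μ.1 : Measure (Rd d)) := by
  refine ⟨by fun_prop, ?_⟩
  have := μ.2
  simpa [hasFiniteIntegral_iff_enorm, secondMoment, enorm_pow] using this

lemma integrable_potV (μ : P2 d) : Integrable potV (μ.1 : Measure (Rd d)) := by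
  refine Integrable.mono' (g := fun x => Real.log 2 + d * ‖x‖ ^ 2)
    ((integrable_const _).add ((integrable_norm_sq μ).const_mul _))
    continuous_potV.aestronglyMeasurable (Eventually.of_forall fun x => ?_)
  rw [Real.norm_of_nonneg (potV_nonneg x)]
  exact potV_le x

lemma extIntegral_congr {ν : Measure (Rd d)} {f g : Rd d → ℝ} (h : f =ᵐ[ν] g) :
    extIntegral ν f = extIntegral ν g := by
  unfold extIntegral
  congr 2
  · exact lintegral_congr_ae (h.fun_comp ENNReal.ofReal)
  · exact lintegral_congr_ae (h.fun_comp fun y => ENNReal.ofReal (-y))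

/-- An integrable g changes the positive and negative parts of f by finite amounts only, so
infinities occur on both sides together. The finite case is the pointwise identity `h5`, written
without subtraction so that it makes sense in `ℝ≥0∞`. -/
lemma extIntegral_add {ν : Measure (Rd d)} {f g : Rd d → ℝ} (hf : Measurable f)
    (hg : Integrable g ν) (hgm : Measurable g) :
    extIntegral ν (fun x => f x + g x) = extIntegral ν f + extIntegral ν g := by
  have hPg : ∫⁻ x, ENNReal.ofReal (g x) ∂ν ≠ ⊤ := hg.lintegral_lt_top.ne
  have hNg : ∫⁻ x, ENNReal.ofReal (-g x) ∂ν ≠ ⊤ := hg.neg.lintegral_lt_top.ne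
  have h1 : ∫⁻ x, ENNReal.ofReal (f x + g x) ∂ν ≤
      ∫⁻ x, ENNReal.ofReal (f x) ∂ν + ∫⁻ x, ENNReal.ofReal (g x) ∂ν := by
    rw [← lintegral_add_left (by fun_prop)]
    exact lintegral_mono fun x => ENNReal.ofReal_add_le
  have h2 : ∫⁻ x, ENNReal.ofReal (f x) ∂ν ≤
      ∫⁻ x, ENNReal.ofReal (f x + g x) ∂ν + ∫⁻ x, ENNReal.ofReal (-g x) ∂ν := by
    rw [← lintegral_add_left (by fun_prop)]
    exact lintegral_mono fun x => by simpa using ENNReal.ofReal_add_le (p := f x + g x) (q := -g x)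
  have h3 : ∫⁻ x, ENNReal.ofReal (-(f x + g x)) ∂ν ≤
      ∫⁻ x, ENNReal.ofReal (-f x) ∂ν + ∫⁻ x, ENNReal.ofReal (-g x) ∂ν := by
    rw [← lintegral_add_left (by fun_prop)]
    refine lintegral_mono fun x => ?_
    rw [neg_add]
    exact ENNReal.ofReal_add_le
  have h4 : ∫⁻ x, ENNReal.ofReal (-f x) ∂ν ≤
      ∫⁻ x, ENNReal.ofReal (-(f x + g x)) ∂ν + ∫⁻ x, ENNReal.ofReal (g x) ∂ν := by
    rw [← lintegral_add_left (by fun_prop)]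
    exact lintegral_mono fun x => by
      simpa using ENNReal.ofReal_add_le (p := -(f x + g x)) (q := g x)
  have h5 : ∫⁻ x, ENNReal.ofReal (f x + g x) ∂ν + ∫⁻ x, ENNReal.ofReal (-f x) ∂ν +
      ∫⁻ x, ENNReal.ofReal (-g x) ∂ν = ∫⁻ x, ENNReal.ofReal (-(f x + g x)) ∂ν +
      ∫⁻ x, ENNReal.ofReal (f x) ∂ν + ∫⁻ x, ENNReal.ofReal (g x) ∂ν := by
    rw [← lintegral_add_left (by fun_prop), ← lintegral_add_left (by fun_prop),
      ← lintegral_add_left (by fun_prop), ← lintegral_add_left (by fun_prop)]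
    refine lintegral_congr fun x => ?_
    rw [← ENNReal.toReal_eq_toReal_iff' (by finiteness) (by finiteness)]
    simp only [ENNReal.toReal_add, ENNReal.ofReal_ne_top, ne_eq, not_false_eq_true,
      ENNReal.add_eq_top, or_self, ENNReal.toReal_ofReal']
    have := max_zero_sub_max_neg_zero_eq_self (f x)
    have := max_zero_sub_max_neg_zero_eq_self (g x)
    have := max_zero_sub_max_neg_zero_eq_self (f x + g x)
    linarith
  unfold extIntegral
  generalize ∫⁻ x, ENNReal.ofReal (f x + g x) ∂ν = P at *
  generalize ∫⁻ x, ENNReal.ofReal (-(f x + g x)) ∂ν = N at *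
  generalize ∫⁻ x, ENNReal.ofReal (f x) ∂ν = Pf at *
  generalize ∫⁻ x, ENNReal.ofReal (-f x) ∂ν = Nf at *
  lift ∫⁻ x, ENNReal.ofReal (g x) ∂ν to NNReal using hPg with Pg
  lift ∫⁻ x, ENNReal.ofReal (-g x) ∂ν to NNReal using hNg with Ng
  -- In `EReal`, subtracting `⊤` always gives `⊥`, and `⊥` absorbs sums; both sides are then `⊥`
  -- whatever the positive parts are.
  by_cases hN : N = ⊤
  · have hNf : Nf = ⊤ := by
      by_contra h
      have : Nf + (Ng : ℝ≥0∞) ≠ ⊤ := by finiteness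
      exact this (top_le_iff.1 (hN ▸ h3))
    simp [hN, hNf]
  have hNf : Nf ≠ ⊤ := ne_top_of_le_ne_top (by finiteness) h4
  by_cases hP : P = ⊤
  · have hPf : Pf = ⊤ := by
      by_contra h
      have : Pf + (Pg : ℝ≥0∞) ≠ ⊤ := by finiteness
      exact this (top_le_iff.1 (hP ▸ h1))
    lift N to NNReal using hN
    lift Nf to NNReal using hNf
    rw [hP, hPf, EReal.coe_ennreal_top]
    have e1 : ∀ r : NNReal, (⊤ : EReal) - (((r : ℝ≥0∞)) : EReal) = ⊤ := fun r =>
      EReal.top_sub_coe (r : ℝ)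
    rw [e1, e1]
    exact (EReal.top_add_coe ((Pg : ℝ) - (Ng : ℝ))).symm
  have hPf : Pf ≠ ⊤ := ne_top_of_le_ne_top (by finiteness) h2
  lift N to NNReal using hN
  lift Nf to NNReal using hNf
  lift P to NNReal using hP
  lift Pf to NNReal using hPf
  have h6 : (P : ℝ) + Nf + Ng = N + Pf + Pg := by exact_mod_cast h5
  have e2 : ∀ a b : NNReal, (((a : ℝ≥0∞)) : EReal) - (((b : ℝ≥0∞)) : EReal) =
      (((a : ℝ) - (b : ℝ) : ℝ) : EReal) := fun a b => rfl
  rw [e2, e2, e2, ← EReal.coe_add]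
  congr 1
  linarith

lemma lintegral_eq_lintegral_dens (μ : PAll d) (hμ : (μ : Measure (Rd d)) ≪ volume)
    {f : Rd d → ℝ≥0∞} (hf : Measurable f) :
    ∫⁻ x, f x ∂(μ : Measure (Rd d)) = ∫⁻ x, ENNReal.ofReal (dens μ x) * f x := by
  rw [← lintegral_rnDeriv_mul hμ hf.aemeasurable]
  refine lintegral_congr_ae ?_
  filter_upwards [Measure.rnDeriv_ne_top (μ : Measure (Rd d)) volume] with x hx
  rw [dens, ENNReal.ofReal_toReal hx]

lemma extIntegral_mul_dens (μ : PAll d) (hμ : (μ : Measure (Rd d)) ≪ volume)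
    {f : Rd d → ℝ} (hf : Measurable f) :
    extIntegral volume (fun x => dens μ x * f x) = extIntegral (μ : Measure (Rd d)) f := by
  unfold extIntegral
  rw [lintegral_eq_lintegral_dens μ hμ (by fun_prop), lintegral_eq_lintegral_dens μ hμ (by fun_prop)]
  simp_rw [← mul_neg, ENNReal.ofReal_mul (dens_nonneg μ _)]

lemma dens_pos_ae (μ : PAll d) (hμ : (μ : Measure (Rd d)) ≪ volume) :
    ∀ᵐ x ∂(μ : Measure (Rd d)), 0 < dens μ x := by
  filter_upwards [Measure.rnDeriv_pos hμ, 
    hμ.ae_le (Measure.rnDeriv_ne_top (μ : Measure (Rd d)) volume)] with x h1 h2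
  exact ENNReal.toReal_pos h1.ne' h2

lemma EFPext_eq_EFP (μ : P2 d) : EFPext μ.1 = EFP μ := by
  unfold EFPext EFP
  split_ifs with hμ
  · rw [extIntegral_mul_dens μ.1 hμ (measurable_dens _).log,
      ← extIntegral_add (measurable_dens _).log (integrable_potV μ) continuous_potV.measurable]
    refine extIntegral_congr ?_
    filter_upwards [dens_pos_ae μ.1 hμ] with x hx
    exact Real.log_mul hx.ne' (one_add_norm_pow_pos x).ne'
  · rfl

/-! ### The second moment of ρ_∞ -/

/-- In polar coordinates the radial integrand is r^{d+1}/(1+r^{2d}), comparable to r^{1-d} on (1,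
∞), and this is integrable there exactly when d > 2. -/
lemma secondMoment_rhoInf (d : ℕ) (hd : 1 ≤ d) : secondMoment (rhoInf d) = ⊤ ↔ d ≤ 2 := by
  have : NeZero d := ⟨by omega⟩
  have hZ : 0 < Zinf d := inv_pos.2 (integral_weight_pos d)
  have h1 : secondMoment (rhoInf d) = ⊤ ↔
      ¬ Integrable (fun x : Rd d => ‖x‖ ^ 2 / (1 + ‖x‖ ^ (2 * d))) := by
    have hm : AEStronglyMeasurable (fun x : Rd d => ‖x‖ ^ 2 / (1 + ‖x‖ ^ (2 * d))) volume :=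
      (Continuous.div (by fun_prop) continuous_weight
        fun x => (one_add_norm_pow_pos x).ne').aestronglyMeasurable
    have h2 : secondMoment (rhoInf d) = ENNReal.ofReal (Zinf d) *
        ∫⁻ x : Rd d, ‖‖x‖ ^ 2 / (1 + ‖x‖ ^ (2 * d))‖ₑ := by
      change ∫⁻ x, ‖x‖ₑ ^ 2 ∂(rhoInfMeasure d) = _
      rw [rhoInfMeasure, lintegral_withDensity_eq_lintegral_mul _ (by fun_prop) (by fun_prop),
        ← lintegral_const_mul' _ _ ENNReal.ofReal_ne_top]
      refine lintegral_congr fun x => ?_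
      have hx := one_add_norm_pow_pos x
      rw [Pi.mul_apply, Real.enorm_of_nonneg (by positivity), ← ofReal_norm,
        ← ENNReal.ofReal_pow (norm_nonneg _), ← ENNReal.ofReal_mul (by positivity),
        ← ENNReal.ofReal_mul hZ.le]
      congr 1
      ring
    rw [h2, ENNReal.mul_eq_top]
    simp [Integrable, hm, hasFiniteIntegral_iff_enorm, hZ]
  rw [h1, not_iff_comm, integrable_fun_norm_addHaar volume
    (f := fun r : ℝ => r ^ 2 / (1 + r ^ (2 * d)))]
  simp only [finrank_euclideanSpace, Fintype.card_fin, smul_eq_mul, not_le]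
  have hcont : ContinuousOn (fun y : ℝ => y ^ (d - 1) * (y ^ 2 / (1 + y ^ (2 * d)))) univ := by
    refine Continuous.continuousOn ?_
    refine Continuous.mul (by fun_prop) (Continuous.div (by fun_prop) (by fun_prop) fun y => ?_)
    have : 0 ≤ y ^ (2 * d) := (even_two_mul d).pow_nonneg y
    positivity
  have hsplit : IntegrableOn (fun y : ℝ => y ^ (d - 1) * (y ^ 2 / (1 + y ^ (2 * d)))) (Ioi 0) ↔
      IntegrableOn (fun y : ℝ => y ^ (d - 1) * (y ^ 2 / (1 + y ^ (2 * d)))) (Ioi 1) := by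
    rw [← Ioc_union_Ioi_eq_Ioi zero_le_one, integrableOn_union, and_iff_right]
    exact ((hcont.mono (subset_univ _)).integrableOn_Icc (a := 0) (b := 1)).mono_set Ioc_subset_Icc_self
  rw [hsplit]
  have hcomp : IntegrableOn (fun y : ℝ => y ^ (d - 1) * (y ^ 2 / (1 + y ^ (2 * d)))) (Ioi 1) ↔
      IntegrableOn (fun y : ℝ => y ^ ((1 : ℝ) - d)) (Ioi 1) := by
    have key : ∀ y : ℝ, 1 < y → y ^ ((1 : ℝ) - d) = y ^ (d - 1) * (y ^ 2 / y ^ (2 * d)) := by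
      intro y hy
      have hy0 : 0 < y := by linarith
      rw [mul_div_assoc', ← pow_add, ← Real.rpow_natCast, ← Real.rpow_natCast, ← Real.rpow_sub hy0]
      congr 1
      push_cast [Nat.cast_sub hd]
      ring
    constructor
    · intro h
      refine Integrable.mono' (h.const_mul 2) (by fun_prop) ?_
      refine (ae_restrict_iff' measurableSet_Ioi).2 (Eventually.of_forall fun y (hy : 1 < y) => ?_)
      have hy0 : 0 < y := by linarith
      rw [key y hy, Real.norm_of_nonneg (by positivity), mul_left_comm]
      have h1 : 1 ≤ y ^ (2 * d) := one_le_pow₀ hy.le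
      gcongr
      rw [mul_div_assoc', div_le_div_iff₀ (by positivity) (by positivity)]
      nlinarith [sq_nonneg y]
    · intro h
      refine Integrable.mono' h ((hcont.mono (subset_univ _)).aestronglyMeasurable
        measurableSet_Ioi) ?_
      refine (ae_restrict_iff' measurableSet_Ioi).2 (Eventually.of_forall fun y (hy : 1 < y) => ?_)
      have hy0 : 0 < y := by linarith
      rw [key y hy, Real.norm_of_nonneg (by positivity)]
      gcongr
      linarith
  rw [hcomp, integrableOn_Ioi_rpow_iff one_pos]
  constructor
  · intro h
    have : (2 : ℝ) < d := by exact_mod_cast h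
    linarith
  · intro h
    have : (2 : ℝ) < d := by linarith
    exact_mod_cast this

/-! ### Vanishing distributional gradient forces a multiple of Lebesgue measure -/

/-- Both measures have locally integrable densities with respect to their sum, and locally
integrable functions are determined by their integrals against test functions. -/
lemma measure_ext_of_integral_contDiff {E : Type*} [NormedAddCommGroup E] [NormedSpace ℝ E]
    [FiniteDimensional ℝ E] [MeasurableSpace E] [BorelSpace E] (η η' : Measure E)
    [IsLocallyFiniteMeasure η] [IsLocallyFiniteMeasure η']
    (h : ∀ ψ : E → ℝ, ContDiff ℝ ∞ ψ → HasCompactSupport ψ → ∫ x, ψ x ∂η = ∫ x, ψ x ∂η') :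
    η = η' := by
  have hlf : IsLocallyFiniteMeasure (η + η') := by
    refine ⟨fun x => ?_⟩
    obtain ⟨s, hs, hs'⟩ := η.finiteAt_nhds x
    obtain ⟨t, ht, ht'⟩ := η'.finiteAt_nhds x
    exact ⟨s ∩ t, inter_mem hs ht, ENNReal.add_lt_top.2
      ⟨(measure_mono inter_subset_left).trans_lt hs', (measure_mono inter_subset_right).trans_lt ht'⟩⟩
  obtain ⟨l, hl, h1, h2⟩ : ∃ l : Measure E, IsLocallyFiniteMeasure l ∧ η ≪ l ∧ η' ≪ l :=
    ⟨η + η', hlf, Measure.absolutelyContinuous_of_le (Measure.le_add_right le_rfl),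
      Measure.absolutelyContinuous_of_le (Measure.le_add_left le_rfl)⟩
  have hloc : ∀ (ζ : Measure E) [IsLocallyFiniteMeasure ζ],
      LocallyIntegrable (fun x => (ζ.rnDeriv l x).toReal) l := by
    intro ζ _
    rw [locallyIntegrable_iff]
    intro K hK
    exact Measure.integrableOn_toReal_rnDeriv hK.measure_lt_top.ne
  have key : ∀ᵐ x ∂l, (η.rnDeriv l x).toReal = (η'.rnDeriv l x).toReal := by
    refine ae_eq_of_integral_contDiff_smul_eq (hloc η) (hloc η') fun ψ hψ hs => ?_
    have e1 := integral_rnDeriv_smul h1 (f := ψ)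
    have e2 := integral_rnDeriv_smul h2 (f := ψ)
    simp_rw [smul_eq_mul] at e1 e2 ⊢
    simp_rw [mul_comm (ψ _)]
    rw [e1, e2, h ψ hψ hs]
  rw [← Measure.withDensity_rnDeriv_eq _ _ h1, ← Measure.withDensity_rnDeriv_eq _ _ h2]
  refine withDensity_congr_ae ?_
  filter_upwards [key, Measure.rnDeriv_ne_top η l, Measure.rnDeriv_ne_top η' l] with x hx hx1 hx2
  exact (ENNReal.toReal_eq_toReal_iff' hx1 hx2).1 hx

/-- The map t ↦ ∫ ψ(tv + x) dη has derivative ∫ ∂_v ψ(tv + x) dη, which vanishes because translates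
of ψ are again test functions. Comparing t = 1 with t = 0 gives invariance under v. -/
lemma isAddLeftInvariant_of_integral_fderiv_eq_zero {E : Type*} [NormedAddCommGroup E]
    [NormedSpace ℝ E] [FiniteDimensional ℝ E] [MeasurableSpace E] [BorelSpace E] (η : Measure E)
    [IsLocallyFiniteMeasure η]
    (h : ∀ ψ : E → ℝ, ContDiff ℝ ∞ ψ → HasCompactSupport ψ → ∀ e, ∫ x, fderiv ℝ ψ x e ∂η = 0) :
    η.IsAddLeftInvariant := by
  refine ⟨fun v => ?_⟩
  have hemb : MeasurableEmbedding fun x : E => v + x := measurableEmbedding_addLeft v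
  have : IsLocallyFiniteMeasure (η.map fun x : E => v + x) := by
    refine ⟨fun x => ⟨(Homeomorph.addLeft v).symm ⁻¹' Metric.closedBall ((Homeomorph.addLeft v).symm x) 1,
      (Homeomorph.addLeft v).symm.continuous.continuousAt.preimage_mem_nhds
        (Metric.closedBall_mem_nhds _ one_pos), ?_⟩⟩
    rw [hemb.map_apply]
    refine lt_of_le_of_lt (measure_mono fun y hy => ?_)
      (isCompact_closedBall (α := E) ((Homeomorph.addLeft v).symm x) 1).measure_lt_top
    have := (Homeomorph.addLeft v).symm_apply_apply y
    simp only [mem_preimage, Homeomorph.coe_addLeft] at hy this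
    rwa [this] at hy
  refine measure_ext_of_integral_contDiff _ _ fun ψ hψ hs => ?_
  rw [hemb.integral_map]
  have hd1 : Differentiable ℝ ψ := hψ.differentiable (by simp)
  have hc : Continuous (fderiv ℝ ψ) := hψ.continuous_fderiv (by simp)
  obtain ⟨C, hC⟩ := hs.fderiv (𝕜 := ℝ) |>.exists_bound_of_continuous hc
  obtain ⟨R, hR⟩ := hs.isCompact.isBounded.subset_closedBall 0
  have hcomp : ∀ w : E, ContDiff ℝ ∞ (fun x => ψ (w + x)) ∧
      HasCompactSupport (fun x => ψ (w + x)) := fun w =>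
    ⟨hψ.comp (contDiff_const.add contDiff_id), hs.comp_homeomorph (Homeomorph.addLeft w)⟩
  have hderiv : ∀ t : ℝ, HasDerivAt (fun s : ℝ => ∫ x, ψ (s • v + x) ∂η) 0 t := by
    intro t
    have h0 : ∫ x, fderiv ℝ ψ (t • v + x) v ∂η = 0 := by
      rw [← h _ (hcomp (t • v)).1 (hcomp (t • v)).2 v]
      simp_rw [fderiv_comp_add_left]
    rw [← h0]
    refine (hasDerivAt_integral_of_dominated_loc_of_deriv_le (s := Metric.ball t 1)
      (F' := fun s x => fderiv ℝ ψ (s • v + x) v)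
      -- For |s - t| < 1 the support of x ↦ ψ(sv + x) stays in this fixed ball, where R bounds the
      -- support of ψ.
      (bound := indicator (Metric.closedBall 0 (R + (|t| + 1) * ‖v‖)) fun _ => C * ‖v‖)
      (Metric.ball_mem_nhds t one_pos) (Eventually.of_forall fun s => ?_) ?_ ?_ ?_ ?_ ?_).2
    · exact (hcomp (s • v)).1.continuous.aestronglyMeasurable
    · exact (hcomp (t • v)).1.continuous.integrable_of_hasCompactSupport (hcomp (t • v)).2
    · exact Continuous.aestronglyMeasurable (by fun_prop)
    · refine Eventually.of_forall fun x s hs' => ?_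
      by_cases hx : x ∈ Metric.closedBall (0 : E) (R + (|t| + 1) * ‖v‖)
      · rw [indicator_of_mem hx]
        exact ((fderiv ℝ ψ (s • v + x)).le_opNorm v).trans (by gcongr; exact hC _)
      · rw [indicator_of_notMem hx, image_eq_zero_of_notMem_tsupport (f := fderiv ℝ ψ)]
        · simp
        · intro hmem
          have h1 := hR (tsupport_fderiv_subset ℝ hmem)
          rw [mem_closedBall_zero_iff] at h1 hx
          have h2 : |s| ≤ |t| + 1 := by
            have h3 : |s - t| < 1 := by simpa [Real.dist_eq] using hs'
            have h4 := abs_sub_abs_le_abs_sub s t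
            linarith
          apply hx
          calc ‖x‖ = ‖(s • v + x) - s • v‖ := by simp
            _ ≤ ‖s • v + x‖ + ‖s • v‖ := norm_sub_le _ _
            _ ≤ R + (|t| + 1) * ‖v‖ := by
              rw [norm_smul, Real.norm_eq_abs]
              gcongr
    · exact (integrable_indicator_iff Metric.isClosed_closedBall.measurableSet).2
        (integrableOn_const (isCompact_closedBall _ _).measure_lt_top.ne)
    · refine Eventually.of_forall fun x s _ => ?_
      have h1 : HasDerivAt (fun s : ℝ => s • v + x) v s := by
        simpa using ((hasDerivAt_id s).smul_const v).add_const x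
      exact (hd1 _).hasFDerivAt.comp_hasDerivAt s h1
  have := is_const_of_deriv_eq_zero (fun t => (hderiv t).differentiableAt)
    (fun t => (hderiv t).deriv) 1 0
  simpa using this

/-- The measure `(1 + |x|^{2d}) μ`. -/
noncomputable def weightedMeasure (μ : PAll d) : Measure (Rd d) :=
  (μ : Measure (Rd d)).withDensity fun x => ENNReal.ofReal (1 + ‖x‖ ^ (2 * d))

instance (μ : PAll d) : IsLocallyFiniteMeasure (weightedMeasure μ) :=
  IsLocallyFiniteMeasure.withDensity_ofReal continuous_weight

lemma integral_weightedMeasure (μ : PAll d) (f : Rd d → ℝ) :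
    ∫ x, f x ∂(weightedMeasure μ) = ∫ x, (1 + ‖x‖ ^ (2 * d)) * f x ∂(μ : Measure (Rd d)) := by
  rw [weightedMeasure, integral_withDensity_eq_integral_toReal_smul (by fun_prop)
    (Eventually.of_forall fun x => ENNReal.ofReal_lt_top)]
  refine integral_congr_ae (Eventually.of_forall fun x => ?_)
  simp only [smul_eq_mul, ENNReal.toReal_ofReal (one_add_norm_pow_pos x).le]

lemma withDensity_weightedMeasure (μ : PAll d) :
    (weightedMeasure μ).withDensity (fun x => ENNReal.ofReal (1 / (1 + ‖x‖ ^ (2 * d)))) = μ := by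
  rw [weightedMeasure, ← withDensity_mul _ (by fun_prop) (by fun_prop)]
  conv_rhs => rw [← withDensity_one (μ := (μ : Measure (Rd d)))]
  congr 1
  ext x
  have := one_add_norm_pow_pos x
  rw [Pi.mul_apply, ← ENNReal.ofReal_mul this.le, mul_one_div_cancel this.ne']
  simp

/-- By uniqueness of Haar measure the weighted measure is c · Lebesgue. Dividing by the weight
leaves one unknown constant, fixed by total mass one. -/
lemma eq_rhoInf_of_integral_fderiv_eq_zero (μ : PAll d)
    (h : ∀ ψ : Rd d → ℝ, ContDiff ℝ ∞ ψ → HasCompactSupport ψ → ∀ e : Rd d,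
      ∫ x, (1 + ‖x‖ ^ (2 * d)) * fderiv ℝ ψ x e ∂(μ : Measure (Rd d)) = 0) :
    μ = rhoInf d := by
  have : (weightedMeasure μ).IsAddLeftInvariant :=
    isAddLeftInvariant_of_integral_fderiv_eq_zero _ fun ψ hψ hs e => by
      rw [integral_weightedMeasure, h ψ hψ hs e]
  have h1 := Measure.isAddLeftInvariant_eq_smul (weightedMeasure μ) (volume : Measure (Rd d))
  generalize Measure.addHaarScalarFactor (weightedMeasure μ) volume = c at h1
  have h2 : (μ : Measure (Rd d)) = (c : ℝ≥0∞) •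
      volume.withDensity fun x : Rd d => ENNReal.ofReal (1 / (1 + ‖x‖ ^ (2 * d))) := by
    rw [← withDensity_weightedMeasure μ, h1]
    exact withDensity_smul_measure _ _
  have h3 : rhoInfMeasure d = ENNReal.ofReal (Zinf d) •
      volume.withDensity fun x : Rd d => ENNReal.ofReal (1 / (1 + ‖x‖ ^ (2 * d))) := by
    rw [rhoInfMeasure, ← withDensity_smul _ (by fun_prop)]
    congr 1
    ext x
    rw [Pi.smul_apply, smul_eq_mul, ← ENNReal.ofReal_mul (show 0 ≤ Zinf d from (inv_pos.2 (integral_weight_pos d)).le),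
      mul_one_div]
  have h4 : ∀ a : ℝ≥0∞, ∀ ν : Measure (Rd d), IsProbabilityMeasure ν →
      ν = a • volume.withDensity (fun x : Rd d => ENNReal.ofReal (1 / (1 + ‖x‖ ^ (2 * d)))) →
      a = (volume.withDensity (fun x : Rd d => ENNReal.ofReal (1 / (1 + ‖x‖ ^ (2 * d)))) univ)⁻¹ := by
    intro a ν hν hav
    refine ENNReal.eq_inv_of_mul_eq_one_left ?_
    rw [← smul_eq_mul, ← Measure.smul_apply, ← hav, measure_univ]
  apply Subtype.ext
  change (μ : Measure (Rd d)) = rhoInfMeasure d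
  rw [h3, h2, h4 _ _ inferInstance h2, h4 _ _ inferInstance h3]

/-! ### The slope controls test integrals; stationary states -/

lemma lintegral_le_rpow_lintegral_sq {α : Type*} [MeasurableSpace α] (μ : Measure α)
    [IsProbabilityMeasure μ] {f : α → ℝ≥0∞} (hf : AEMeasurable f μ) :
    ∫⁻ x, f x ∂μ ≤ (∫⁻ x, f x ^ 2 ∂μ) ^ (1 / 2 : ℝ) := by
  have := ENNReal.lintegral_mul_le_Lp_mul_Lq μ Real.HolderConjugate.two_two hf
    (aemeasurable_const (b := (1 : ℝ≥0∞)))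
  simpa using this

lemma integral_weightedDens_mul (μ : PAll d) (hμ : (μ : Measure (Rd d)) ≪ volume)
    (f : Rd d → ℝ) : ∫ x, weightedDens μ x * f x =
      ∫ x, (1 + ‖x‖ ^ (2 * d)) * f x ∂(μ : Measure (Rd d)) := by
  rw [← integral_rnDeriv_smul hμ]
  refine integral_congr_ae (Eventually.of_forall fun x => ?_)
  simp only [weightedDens, dens, smul_eq_mul, mul_assoc]

/-- For every admissible w, integration by parts moves the derivative from ψ onto w; Cauchy–Schwarz
against the probability measure μ then bounds the result by the L²(μ) norm of w. The constant
depends only on ψ and e. -/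
lemma exists_integral_fderiv_le_GFPext {ψ : Rd d → ℝ} (hψ : ContDiff ℝ ∞ ψ)
    (hs : HasCompactSupport ψ) (e : Rd d) :
    ∃ C : ℝ≥0∞, C ≠ 0 ∧ C ≠ ⊤ ∧ ∀ μ : PAll d,
      ‖∫ x, (1 + ‖x‖ ^ (2 * d)) * fderiv ℝ ψ x e ∂(μ : Measure (Rd d))‖ₑ / C ≤ GFPext μ := by
  obtain ⟨C, hC⟩ := (hs.mul_left (f := fun x : Rd d => (1 + ‖x‖ ^ (2 * d)))).exists_bound_of_continuous
    (continuous_weight.mul hψ.continuous)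
  have hC0 : 0 ≤ C := (norm_nonneg _).trans (hC 0)
  -- The added 1 keeps the divisor nonzero when ψ or e vanishes.
  refine ⟨ENNReal.ofReal (C * ‖e‖ + 1), by positivity, ENNReal.ofReal_ne_top, fun μ => ?_⟩
  refine le_iInf₂ fun w hw => ENNReal.div_le_of_le_mul' ?_
  obtain ⟨hμ, hw2, hw3⟩ := hw
  have h1 := hw3 ψ hψ hs e
  simp_rw [mul_assoc] at h1
  rw [integral_weightedDens_mul μ hμ, integral_weightedDens_mul μ hμ] at h1
  rw [h1, enorm_neg]
  calc _ ≤ ∫⁻ x, ‖(1 + ‖x‖ ^ (2 * d)) * (inner ℝ (w x) e * ψ x)‖ₑ ∂(μ : Measure (Rd d)) :=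
        enorm_integral_le_lintegral_enorm _
    _ ≤ ∫⁻ x, ENNReal.ofReal (C * ‖e‖ + 1) * ‖w x‖ₑ ∂(μ : Measure (Rd d)) := by
        refine lintegral_mono fun x => ?_
        rw [← ofReal_norm, ← ofReal_norm, ← ENNReal.ofReal_mul (by positivity)]
        refine ENNReal.ofReal_le_ofReal ?_
        have h2 := hC x
        have h3 := abs_real_inner_le_norm (w x) e
        calc ‖(1 + ‖x‖ ^ (2 * d)) * (inner ℝ (w x) e * ψ x)‖
            = ‖(1 + ‖x‖ ^ (2 * d)) * ψ x‖ * |inner ℝ (w x) e| := by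
              rw [← Real.norm_eq_abs, ← norm_mul]; ring_nf
          _ ≤ C * (‖w x‖ * ‖e‖) := mul_le_mul h2 h3 (abs_nonneg _) hC0
          _ ≤ (C * ‖e‖ + 1) * ‖w x‖ := by nlinarith [norm_nonneg (w x)]
    _ = ENNReal.ofReal (C * ‖e‖ + 1) * ∫⁻ x, ‖w x‖ₑ ∂(μ : Measure (Rd d)) :=
        lintegral_const_mul' _ _ ENNReal.ofReal_ne_top
    _ ≤ _ := by
        gcongr
        exact lintegral_le_rpow_lintegral_sq _ hw2.1.enorm

lemma integral_fderiv_apply_eq_zero {ψ : Rd d → ℝ} (hψ : ContDiff ℝ ∞ ψ)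
    (hs : HasCompactSupport ψ) (e : Rd d) : ∫ x, fderiv ℝ ψ x e = 0 := by
  have hc : Continuous (fun x => fderiv ℝ ψ x e) :=
    (hψ.continuous_fderiv (by simp)).clm_apply continuous_const
  have := integral_mul_fderiv_eq_neg_fderiv_mul_of_integrable (μ := (volume : Measure (Rd d)))
    (f := fun _ => (1 : ℝ)) (g := ψ) (v := e) (by simp)
    (by simpa using hc.integrable_of_hasCompactSupport (hs.fderiv_apply (𝕜 := ℝ) e))
    (by simpa using hψ.continuous.integrable_of_hasCompactSupport hs)
    (fun x _ => by simp) (fun x _ => hψ.differentiable (by simp) x)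
  simpa using this

lemma Zinf_pos (d : ℕ) : 0 < Zinf d := inv_pos.2 (integral_weight_pos d)

lemma rhoInf_absolutelyContinuous (d : ℕ) : (rhoInf d : Measure (Rd d)) ≪ volume :=
  withDensity_absolutelyContinuous _ _

lemma weightedDens_rhoInf (d : ℕ) : weightedDens (rhoInf d) =ᵐ[volume] fun _ => Zinf d := by
  have h := Measure.rnDeriv_withDensity (volume : Measure (Rd d))
    (f := fun x => ENNReal.ofReal (Zinf d / (1 + ‖x‖ ^ (2 * d)))) (by fun_prop)
  filter_upwards [h] with x hx
  have hx0 := one_add_norm_pow_pos x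
  have hZ := Zinf_pos d
  change ((rhoInfMeasure d).rnDeriv volume x).toReal * (1 + ‖x‖ ^ (2 * d)) = Zinf d
  rw [rhoInfMeasure, hx, ENNReal.toReal_ofReal (by positivity), div_mul_cancel₀ _ hx0.ne']

lemma isWeakStationaryState_rhoInf (d : ℕ) :
    IsWeakStationaryState EFPext GFPext (rhoInf d) := by
  have hac := rhoInf_absolutelyContinuous d
  constructor
  · rw [EFPext, if_pos hac, extIntegral_congr (g := fun _ => Real.log (Zinf d))
      (by filter_upwards [hac.ae_le (weightedDens_rhoInf d)] with x hx; rw [hx])]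
    unfold extIntegral
    simp only [lintegral_const, measure_univ, mul_one]
    rw [sub_eq_add_neg]
    refine EReal.add_lt_top ?_ ?_
    · simp
    · simp
  · have hw : IsLogGradient (rhoInf d) fun _ => 0 := by
      refine ⟨hac, MemLp.zero, fun ψ hψ hs e => ?_⟩
      rw [integral_congr_ae (g := fun x => Zinf d * fderiv ℝ ψ x e)
        (by filter_upwards [weightedDens_rhoInf d] with x hx; rw [hx]), integral_const_mul,
        integral_fderiv_apply_eq_zero hψ hs]
      simp
    refine le_antisymm ((iInf₂_le _ hw).trans ?_) zero_le
    simp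

lemma eq_rhoInf_of_GFPext_eq_zero (μ : PAll d) (h : GFPext μ = 0) : μ = rhoInf d := by
  refine eq_rhoInf_of_integral_fderiv_eq_zero μ fun ψ hψ hs e => ?_
  obtain ⟨C, hC0, hC, hle⟩ := exists_integral_fderiv_le_GFPext hψ hs e
  have := hle μ
  rw [h, nonpos_iff_eq_zero, ENNReal.div_eq_zero_iff] at this
  simpa [hC] using this

/-! ### Lower bound and tightness from the relative entropy -/

/-- The measure `dx / (1 + |x|^{2d})`. -/
noncomputable def invWeightMeasure (d : ℕ) : Measure (Rd d) :=
  volume.withDensity fun x => ENNReal.ofReal (1 / (1 + ‖x‖ ^ (2 * d)))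

instance (d : ℕ) : IsFiniteMeasure (invWeightMeasure d) :=
  isFiniteMeasure_withDensity_ofReal (integrable_weight d).2

/-- With h = ρ(1+|x|^{2d}), one has -h log h ≤ 1 - h ≤ 1; divide by the weight and integrate. -/
lemma lintegral_neg_log_weightedDens_le (μ : PAll d) (hμ : (μ : Measure (Rd d)) ≪ volume) :
    ∫⁻ x, ENNReal.ofReal (-Real.log (weightedDens μ x)) ∂(μ : Measure (Rd d)) ≤
      invWeightMeasure d univ := by
  have hm : Measurable fun x => ENNReal.ofReal (-Real.log (weightedDens μ x)) :=
    (measurable_weightedDens μ).log.neg.ennreal_ofReal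
  rw [lintegral_eq_lintegral_dens μ hμ hm,
    invWeightMeasure, withDensity_apply _ MeasurableSet.univ, Measure.restrict_univ]
  refine lintegral_mono fun x => ?_
  rw [← ENNReal.ofReal_mul (dens_nonneg μ x)]
  refine ENNReal.ofReal_le_ofReal ?_
  have hx := one_add_norm_pow_pos x
  rw [le_div_iff₀ hx]
  have h1 : weightedDens μ x * -Real.log (weightedDens μ x) ≤ 1 := by
    rcases (weightedDens_nonneg μ x).eq_or_lt with h | h
    · simp [← h]
    · have h2 := Real.one_sub_inv_le_log_of_pos h
      have h3 := mul_le_mul_of_nonneg_left h2 h.le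
      rw [mul_sub, mul_inv_cancel₀ h.ne'] at h3
      linarith
  calc _ = weightedDens μ x * -Real.log (weightedDens μ x) := by
        simp only [weightedDens]; ring
    _ ≤ 1 := h1

lemma neg_invWeightMeasure_le_EFPext (μ : PAll d) :
    ((-(invWeightMeasure d univ).toReal : ℝ) : EReal) ≤ EFPext μ := by
  unfold EFPext
  split_ifs with hμ
  · have h := lintegral_neg_log_weightedDens_le μ hμ
    have h1 : ((∫⁻ x, ENNReal.ofReal (-Real.log (weightedDens μ x)) ∂(μ : Measure (Rd d)) :
        ℝ≥0∞) : EReal) ≤ ((invWeightMeasure d univ).toReal : ℝ) := by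
      rw [EReal.coe_ennreal_toReal (measure_ne_top _ _)]
      exact EReal.coe_ennreal_le_coe_ennreal_iff.2 h
    rw [extIntegral, sub_eq_add_neg, EReal.coe_neg, ← zero_add (-((_ : ℝ) : EReal))]
    exact add_le_add (EReal.coe_ennreal_nonneg _) (EReal.neg_le_neg_iff.2 h1)
  · exact le_top

lemma absolutelyContinuous_of_EFPext_le {μ : PAll d} {C : ℝ} (h : EFPext μ ≤ C) :
    (μ : Measure (Rd d)) ≪ volume := by
  by_contra hμ
  rw [EFPext, if_neg hμ] at h
  exact absurd (top_le_iff.1 h) (EReal.coe_ne_top C)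

lemma lintegral_log_weightedDens_le {μ : PAll d} {C : ℝ} (h : EFPext μ ≤ C) :
    ∫⁻ x, ENNReal.ofReal (Real.log (weightedDens μ x)) ∂(μ : Measure (Rd d)) ≤
      ENNReal.ofReal C + invWeightMeasure d univ := by
  have hμ := absolutelyContinuous_of_EFPext_le h
  have hN := lintegral_neg_log_weightedDens_le μ hμ
  rw [EFPext, if_pos hμ, extIntegral] at h
  refine le_trans ?_ (add_le_add_right hN _)
  have hN' := ne_top_of_le_ne_top (measure_ne_top _ _) hN
  generalize ∫⁻ x, ENNReal.ofReal (Real.log (weightedDens μ x)) ∂(μ : Measure (Rd d)) = P at *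
  generalize ∫⁻ x, ENNReal.ofReal (-Real.log (weightedDens μ x)) ∂(μ : Measure (Rd d)) = N at *
  lift N to NNReal using hN'
  have hP : P ≠ ⊤ := by
    rintro rfl
    rw [EReal.coe_ennreal_top] at h
    have : (⊤ : EReal) - (((N : ℝ≥0∞)) : EReal) = ⊤ := EReal.top_sub_coe (N : ℝ)
    rw [this] at h
    exact absurd (top_le_iff.1 h) (EReal.coe_ne_top C)
  lift P to NNReal using hP
  have h1 : (P : ℝ) - N ≤ C := by
    have e : (((P : ℝ≥0∞)) : EReal) - (((N : ℝ≥0∞)) : EReal) = (((P : ℝ) - (N : ℝ) : ℝ) : EReal) := rfl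
    rw [e] at h
    exact_mod_cast h
  rw [← ENNReal.ofReal_coe_nnreal, ← ENNReal.ofReal_coe_nnreal (p := N)]
  refine le_trans (ENNReal.ofReal_le_ofReal (q := C + N) (by linarith)) ENNReal.ofReal_add_le

/-- Split A at the level h = eⁿ. Below it, ρ is at most eⁿ times the reference density; above it,
log h > n and Markov's inequality applies to the positive part of log h. -/
lemma measure_le_of_EFPext_le {μ : PAll d} {C : ℝ} (h : EFPext μ ≤ C) {n : ℕ} (hn : n ≠ 0)
    {A : Set (Rd d)} (hA : MeasurableSet A) :
    (μ : Measure (Rd d)) A ≤ ENNReal.ofReal (Real.exp n) * invWeightMeasure d A +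
      (ENNReal.ofReal C + invWeightMeasure d univ) / n := by
  have hμ := absolutelyContinuous_of_EFPext_le h
  set B : Set (Rd d) := {x | weightedDens μ x ≤ Real.exp n} with hB
  have hBm : MeasurableSet B := measurableSet_le (measurable_weightedDens μ) measurable_const
  refine (measure_le_inter_add_sdiff _ A B).trans (add_le_add ?_ ?_)
  · calc (μ : Measure (Rd d)) (A ∩ B) = ∫⁻ x, (A ∩ B).indicator 1 x ∂(μ : Measure (Rd d)) := by
          rw [lintegral_indicator_one (hA.inter hBm)]
      _ = ∫⁻ x, ENNReal.ofReal (dens μ x) * (A ∩ B).indicator 1 x :=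
          lintegral_eq_lintegral_dens μ hμ (measurable_one.indicator (hA.inter hBm))
      _ ≤ ∫⁻ x, A.indicator (fun x => ENNReal.ofReal (Real.exp n) *
            ENNReal.ofReal (1 / (1 + ‖x‖ ^ (2 * d)))) x := by
          refine lintegral_mono fun x => ?_
          by_cases hx : x ∈ A ∩ B
          · rw [indicator_of_mem hx, indicator_of_mem hx.1, Pi.one_apply, mul_one,
              ← ENNReal.ofReal_mul (Real.exp_pos _).le]
            refine ENNReal.ofReal_le_ofReal ?_
            rw [mul_one_div, le_div_iff₀ (one_add_norm_pow_pos x)]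
            exact hx.2
          · simp [indicator_of_notMem hx]
      _ = _ := by
          rw [lintegral_indicator hA, lintegral_const_mul' _ _ ENNReal.ofReal_ne_top,
            invWeightMeasure, withDensity_apply _ hA]
  · have h1 := meas_ge_le_lintegral_div (μ := (μ : Measure (Rd d)))
      (f := fun x => ENNReal.ofReal (Real.log (weightedDens μ x)))
      (measurable_weightedDens μ).log.ennreal_ofReal.aemeasurable (ε := n)
      (by simpa using hn) (by simp)
    refine (measure_mono fun x hx => ?_).trans (h1.trans ?_)
    · have hx2 : Real.exp n < weightedDens μ x := not_le.1 hx.2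
      change (n : ℝ≥0∞) ≤ _
      rw [← ENNReal.ofReal_natCast]
      refine ENNReal.ofReal_le_ofReal ?_
      rw [Real.le_log_iff_exp_le ((Real.exp_pos _).trans hx2)]
      exact hx2.le
    · gcongr
      exact lintegral_log_weightedDens_le h

lemma isTightMeasureSet_EFPext_le (C : ℝ) :
    IsTightMeasureSet {((μ : PAll d) : Measure (Rd d)) | μ ∈ {μ : PAll d | EFPext μ ≤ C}} := by
  rw [isTightMeasureSet_iff_exists_isCompact_measure_compl_le]
  intro ε hε
  have hε2 : ε / 2 ≠ 0 := (ENNReal.half_pos hε.ne').ne'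
  -- First n makes the entropy term small; only then is K chosen, small enough outside to beat the
  -- factor eⁿ.
  obtain ⟨n, hn⟩ := ENNReal.exists_nat_mul_gt hε2
    (b := ENNReal.ofReal C + invWeightMeasure d univ) (by finiteness)
  have hn0 : n ≠ 0 := by
    rintro rfl
    simp at hn
  obtain ⟨K, hK, hKle⟩ := isTightMeasureSet_iff_exists_isCompact_measure_compl_le.1
    (isTightMeasureSet_singleton (μ := invWeightMeasure d)) (ε / 2 / ENNReal.ofReal (Real.exp n))
    (ENNReal.div_pos hε2 ENNReal.ofReal_ne_top)
  refine ⟨K, hK, ?_⟩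
  rintro _ ⟨μ, hμ, rfl⟩
  refine (measure_le_of_EFPext_le hμ hn0 hK.measurableSet.compl).trans ?_
  rw [← ENNReal.add_halves ε]
  refine add_le_add ?_ (ENNReal.div_le_of_le_mul' hn.le)
  exact (mul_le_mul_right (hKle _ rfl) _).trans ENNReal.mul_div_le

/-- By Prokhorov's theorem it suffices to identify cluster points. The weighted test integrals are
narrowly continuous and dominated by the slopes, so they vanish at every cluster point. -/
lemma tendsto_rhoInf_of_GFPext_tendsto_zero {ι : Type*} {l : Filter ι} {ν : ι → PAll d} {C : ℝ}
    (hE : ∀ᶠ i in l, EFPext (ν i) ≤ C) (hG : Tendsto (fun i => GFPext (ν i)) l (𝓝 0)) :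
    Tendsto ν l (𝓝 (rhoInf d)) := by
  refine (isCompact_closure_of_isTightMeasureSet
    (isTightMeasureSet_EFPext_le C)).tendsto_nhds_of_unique_mapClusterPt
    (hE.mono fun i hi => subset_closure hi) fun μ _ hμ => ?_
  refine eq_rhoInf_of_integral_fderiv_eq_zero μ fun ψ hψ hs e => ?_
  obtain ⟨C, hC0, hC, hle⟩ := exists_integral_fderiv_le_GFPext hψ hs e
  have hc : Continuous fun x => (1 + ‖x‖ ^ (2 * d)) * fderiv ℝ ψ x e :=
    continuous_weight.mul ((hψ.continuous_fderiv (by simp)).clm_apply continuous_const)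
  have hcs : HasCompactSupport fun x => (1 + ‖x‖ ^ (2 * d)) * fderiv ℝ ψ x e :=
    (hs.fderiv_apply (𝕜 := ℝ) e).mul_left
  obtain ⟨M, hM⟩ := hcs.exists_bound_of_continuous hc
  let f : BoundedContinuousFunction (Rd d) ℝ := BoundedContinuousFunction.ofNormedAddCommGroup _ hc M hM
  have hf : Continuous fun μ : PAll d => ∫ x, f x ∂(μ : Measure (Rd d)) :=
    continuous_iff_continuousAt.2 fun μ =>
      (ProbabilityMeasure.tendsto_iff_forall_integral_tendsto.1 tendsto_id) f
  have h1 : MapClusterPt (∫ x, f x ∂(μ : Measure (Rd d))) l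
      fun i => ∫ x, f x ∂(ν i : Measure (Rd d)) := hμ.continuousAt_comp hf.continuousAt
  have h2 : Tendsto (fun i => ∫ x, f x ∂(ν i : Measure (Rd d))) l (𝓝 0) := by
    rw [tendsto_zero_iff_enorm_tendsto_zero]
    have h3 : Tendsto (fun i => C * GFPext (ν i)) l (𝓝 0) := by
      simpa using ENNReal.Tendsto.const_mul hG (Or.inr hC)
    refine tendsto_of_tendsto_of_tendsto_of_le_of_le tendsto_const_nhds h3 (fun _ => zero_le)
      fun i => ?_
    exact (ENNReal.div_le_iff' hC0 hC).1 (hle (ν i))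
  exact eq_of_nhds_neBot (ClusterPt.mono h1 h2)

/-! ### Wasserstein distance against Lipschitz functions -/

/-- The infimum of the quadratic transport cost over all couplings of `μ` and `ν`. -/
noncomputable def transportCost (μ ν : P2 d) : ℝ≥0∞ :=
  ⨅ (π : Measure (Rd d × Rd d))
      (_ : π.map Prod.fst = (μ.1 : Measure (Rd d)) ∧ π.map Prod.snd = (ν.1 : Measure (Rd d))),
      ∫⁻ z, edist z.1 z.2 ^ 2 ∂π

/-- The product coupling has finite cost. This matters because `W2` passes through `toReal`, which
would turn an infinite cost into distance zero. -/
lemma transportCost_lt_top (μ ν : P2 d) : transportCost μ ν < ⊤ := by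
  refine (iInf₂_le ((μ.1 : Measure (Rd d)).prod (ν.1 : Measure (Rd d)))
    ⟨by simp [Measure.map_fst_prod], by simp [Measure.map_snd_prod]⟩).trans_lt ?_
  have h1 : ∫⁻ z, ‖z.1‖ₑ ^ 2 ∂((μ.1 : Measure (Rd d)).prod (ν.1 : Measure (Rd d))) < ⊤ := by
    rw [lintegral_prod _ (by fun_prop)]
    simpa using! μ.2
  have h2 : ∫⁻ z, ‖z.2‖ₑ ^ 2 ∂((μ.1 : Measure (Rd d)).prod (ν.1 : Measure (Rd d))) < ⊤ := by
    rw [lintegral_prod _ (by fun_prop)]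
    simpa using! ν.2
  calc _ ≤ ∫⁻ z, 2 * ‖z.1‖ₑ ^ 2 + 2 * ‖z.2‖ₑ ^ 2
        ∂((μ.1 : Measure (Rd d)).prod (ν.1 : Measure (Rd d))) := by
        refine lintegral_mono fun z => ?_
        rw [edist_eq_enorm_sub, ← ofReal_norm, ← ofReal_norm, ← ofReal_norm]
        have h3 := norm_sub_le z.1 z.2
        have h4 := norm_nonneg (z.1 - z.2)
        have h5 := norm_nonneg z.1
        have h6 := norm_nonneg z.2
        generalize ‖z.1 - z.2‖ = a at *
        generalize ‖z.1‖ = b at *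
        generalize ‖z.2‖ = c at *
        rw [← ENNReal.ofReal_pow h4, ← ENNReal.ofReal_pow h5, ← ENNReal.ofReal_pow h6,
          ← ENNReal.ofReal_ofNat 2, ← ENNReal.ofReal_mul zero_le_two,
          ← ENNReal.ofReal_mul zero_le_two, ← ENNReal.ofReal_add (by positivity) (by positivity)]
        exact ENNReal.ofReal_le_ofReal (by nlinarith [sq_nonneg (b - c)])
    _ < ⊤ := by
        rw [lintegral_add_left (by fun_prop), lintegral_const_mul _ (by fun_prop),
          lintegral_const_mul _ (by fun_prop)]
        finiteness

lemma W2_nonneg (μ ν : P2 d) : 0 ≤ W2 μ ν := ENNReal.toReal_nonneg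

lemma integrable_of_lipschitz_of_bounded {μ : PAll d} {f : Rd d → ℝ} {L : NNReal}
    (hf : LipschitzWith L f) (hb : ∃ C : ℝ, ∀ x y, dist (f x) (f y) ≤ C) :
    Integrable f (μ : Measure (Rd d)) := by
  obtain ⟨C, hC⟩ := hb
  refine Integrable.of_bound hf.continuous.aestronglyMeasurable (C + ‖f 0‖)
    (Eventually.of_forall fun x => ?_)
  have := hC x 0
  rw [dist_eq_norm] at this
  calc ‖f x‖ = ‖(f x - f 0) + f 0‖ := by simp
    _ ≤ ‖f x - f 0‖ + ‖f 0‖ := norm_add_le _ _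
    _ ≤ _ := by gcongr

/-- The easy half of Kantorovich duality: for any coupling the difference is ∫ (f(x) - f(y)) dπ, at
most L ∫ |x - y| dπ, and Cauchy–Schwarz gives the quadratic cost. -/
lemma abs_integral_sub_le_W2 (μ ν : P2 d) {f : Rd d → ℝ} {L : NNReal} (hf : LipschitzWith L f)
    (hb : ∃ C : ℝ, ∀ x y, dist (f x) (f y) ≤ C) :
    |∫ x, f x ∂(μ.1 : Measure (Rd d)) - ∫ x, f x ∂(ν.1 : Measure (Rd d))| ≤ L * W2 μ ν := by
  set D := ∫ x, f x ∂(μ.1 : Measure (Rd d)) - ∫ x, f x ∂(ν.1 : Measure (Rd d)) with hD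
  have key : (‖D‖ₑ / L) ^ 2 ≤ transportCost μ ν := by
    refine le_iInf₂ fun π hπ => ?_
    have hπ1 : IsProbabilityMeasure π := by
      constructor
      have : π.map Prod.fst univ = 1 := by rw [hπ.1]; exact measure_univ
      rwa [Measure.map_apply measurable_fst MeasurableSet.univ, preimage_univ] at this
    have hi1 : Integrable (fun z : Rd d × Rd d => f z.1) π :=
      (hπ.1 ▸ integrable_of_lipschitz_of_bounded hf hb :
        Integrable f (π.map Prod.fst)).comp_measurable measurable_fst
    have hi2 : Integrable (fun z : Rd d × Rd d => f z.2) π :=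
      (hπ.2 ▸ integrable_of_lipschitz_of_bounded hf hb :
        Integrable f (π.map Prod.snd)).comp_measurable measurable_snd
    have h1 : D = ∫ z, (f z.1 - f z.2) ∂π := by
      rw [integral_sub hi1 hi2, hD, ← hπ.1, ← hπ.2,
        integral_map measurable_fst.aemeasurable hf.continuous.aestronglyMeasurable,
        integral_map measurable_snd.aemeasurable hf.continuous.aestronglyMeasurable]
    have h2 : ‖D‖ₑ ≤ L * ∫⁻ z, edist z.1 z.2 ∂π := by
      rw [h1, ← lintegral_const_mul' _ _ ENNReal.coe_ne_top]
      refine (enorm_integral_le_lintegral_enorm _).trans (lintegral_mono fun z => ?_)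
      rw [← edist_eq_enorm_sub]
      exact hf z.1 z.2
    have h3 : ‖D‖ₑ / L ≤ (∫⁻ z, edist z.1 z.2 ^ 2 ∂π) ^ (1 / 2 : ℝ) :=
      (ENNReal.div_le_of_le_mul' h2).trans (lintegral_le_rpow_lintegral_sq π (by fun_prop))
    calc (‖D‖ₑ / L) ^ 2 ≤ ((∫⁻ z, edist z.1 z.2 ^ 2 ∂π) ^ (1 / 2 : ℝ)) ^ 2 := by gcongr
      _ = _ := by
        rw [← ENNReal.rpow_natCast, ← ENNReal.rpow_mul]
        norm_num
  have hW : ‖D‖ₑ / L ≤ transportCost μ ν ^ (1 / 2 : ℝ) := by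
    calc ‖D‖ₑ / L = ((‖D‖ₑ / L) ^ 2) ^ (1 / 2 : ℝ) := by
          rw [← ENNReal.rpow_natCast, ← ENNReal.rpow_mul]
          norm_num
      _ ≤ _ := by gcongr
  have hfin : transportCost μ ν ^ (1 / 2 : ℝ) ≠ ⊤ :=
    ENNReal.rpow_ne_top_of_nonneg (by norm_num) (transportCost_lt_top μ ν).ne
  have h4 : ‖D‖ₑ ≤ L * transportCost μ ν ^ (1 / 2 : ℝ) := by
    -- For L = 0 the quotient in `hW` would be `⊤` unless the difference vanishes, and the cost is
    -- finite.
    rcases eq_or_ne L 0 with rfl | hL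
    · by_contra hne
      have h0 : ‖D‖ₑ ≠ 0 := fun h => hne (by rw [h]; exact zero_le)
      rw [ENNReal.coe_zero, ENNReal.div_zero h0] at hW
      exact hfin (top_le_iff.1 hW)
    · exact (ENNReal.div_le_iff' (by simpa using hL) ENNReal.coe_ne_top).1 hW
  have h5 := ENNReal.toReal_mono (by finiteness) h4
  rw [toReal_enorm, Real.norm_eq_abs, ENNReal.toReal_mul, ENNReal.coe_toReal] at h5
  exact h5

/-! ### Estimates along curves of maximal slope -/

lemma AbsolutelyContinuousOnInterval.of_dist_le {f M : ℝ → ℝ} {a b C : ℝ}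
    (hM : AbsolutelyContinuousOnInterval M a b)
    (h : ∀ x ∈ uIcc a b, ∀ y ∈ uIcc a b, dist (f x) (f y) ≤ C * dist (M x) (M y)) :
    AbsolutelyContinuousOnInterval f a b := by
  have h1 := Tendsto.const_mul C hM
  rw [mul_zero] at h1
  refine tendsto_of_tendsto_of_tendsto_of_le_of_le' tendsto_const_nhds h1
    (Eventually.of_forall fun E => Finset.sum_nonneg fun _ _ => dist_nonneg) ?_
  filter_upwards [mem_inf_of_right (mem_principal_self _)] with E hE
  rw [Finset.mul_sum]
  exact Finset.sum_le_sum fun i hi => h _ (hE.1 i hi).1 _ (hE.1 i hi).2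

lemma IsACCurve.absolutelyContinuousOnInterval {ρ : ℝ → P2 d} (hρ : IsACCurve ρ)
    {f : Rd d → ℝ} {L : NNReal} (hf : LipschitzWith L f)
    (hb : ∃ C : ℝ, ∀ x y, dist (f x) (f y) ≤ C) {s t : ℝ} (hs : 0 ≤ s) (hst : s ≤ t) :
    AbsolutelyContinuousOnInterval (fun r => ∫ x, f x ∂((ρ r).1 : Measure (Rd d))) s t := by
  -- The horizon must be positive and t may be 0, hence t + 1.
  obtain ⟨m, hm, hW⟩ := hρ (t + 1) (by linarith)
  have hint : ∀ a b, 0 ≤ a → a ≤ b → b ≤ t → IntervalIntegrable m volume a b := by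
    intro a b ha hab hbt
    rw [intervalIntegrable_iff_integrableOn_Icc_of_le hab]
    exact hm.mono_set (Icc_subset_Icc ha (by linarith))
  refine AbsolutelyContinuousOnInterval.of_dist_le (C := L)
    ((hint s t hs hst le_rfl).absolutelyContinuousOnInterval_intervalIntegral
      (c := s) left_mem_uIcc) ?_
  rw [uIcc_of_le hst]
  have main : ∀ x ∈ Icc s t, ∀ y ∈ Icc s t, x < y →
      dist (∫ z, f z ∂((ρ y).1 : Measure (Rd d))) (∫ z, f z ∂((ρ x).1 : Measure (Rd d))) ≤
        L * dist (∫ v in s..y, m v) (∫ v in s..x, m v) := by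
    intro x hx y hy hxy
    rw [Real.dist_eq, Real.dist_eq, intervalIntegral.integral_interval_sub_left
      (hint s y hs hy.1 hy.2) (hint s x hs hx.1 hx.2)]
    refine (abs_integral_sub_le_W2 _ _ hf hb).trans ?_
    gcongr
    exact (hW x y (hs.trans hx.1) hxy (by linarith [hy.2])).trans (le_abs_self _)
  intro x hx y hy
  rcases lt_trichotomy x y with h | rfl | h
  · rw [dist_comm, dist_comm (∫ v in s..x, m v)]
    exact main x hx y hy h
  · simp
  · exact main y hy x hx h

lemma HasMetricDerivAt.abs_deriv_le {ρ : ℝ → P2 d} {v t : ℝ} (h : HasMetricDerivAt ρ v t)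
    {f : Rd d → ℝ} {L : NNReal} (hf : LipschitzWith L f)
    (hb : ∃ C : ℝ, ∀ x y, dist (f x) (f y) ≤ C) :
    |deriv (fun r => ∫ x, f x ∂((ρ r).1 : Measure (Rd d))) t| ≤ L * v := by
  by_cases hd : DifferentiableAt ℝ (fun r => ∫ x, f x ∂((ρ r).1 : Measure (Rd d))) t
  · refine le_of_tendsto_of_tendsto' (hasDerivAt_iff_tendsto_slope.1 hd.hasDerivAt).abs
      (h.const_mul (L : ℝ)) fun s => ?_
    rw [slope_def_field, abs_div, abs_sub_comm s t, mul_div_assoc', abs_sub_comm]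
    gcongr
    exact abs_integral_sub_le_W2 _ _ hf hb
  · rw [deriv_zero_of_not_differentiableAt hd, abs_zero]
    have : 0 ≤ v := ge_of_tendsto' h fun s => div_nonneg (W2_nonneg _ _) (abs_nonneg _)
    positivity

/-- A monotone function may also drop through jumps or a singular part, so only an inequality holds.
It is the useful one: the integral of -φ' is at most the drop of φ. -/
lemma AntitoneOn.sub_le_integral_deriv {φ : ℝ → ℝ} {s t : ℝ} (hst : s ≤ t)
    (hφ : AntitoneOn φ (Icc s t)) :
    IntervalIntegrable (deriv φ) volume s t ∧ φ t - φ s ≤ ∫ r in s..t, deriv φ r := by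
  have hm : MonotoneOn (fun r => -φ r) (uIcc s t) := by
    rw [uIcc_of_le hst]
    exact hφ.neg
  have h1 := hm.intervalIntegrable_deriv
  have h2 := hm.intervalIntegral_deriv_mem_uIcc
  have h3 : deriv (fun r => -φ r) = fun r => -deriv φ r := by
    ext r
    exact deriv.fun_neg
  rw [h3] at h1 h2
  rw [intervalIntegral.integral_neg, uIcc_of_le
    (by linarith [hφ (left_mem_Icc.2 hst) (right_mem_Icc.2 hst) hst])] at h2
  exact ⟨by convert h1.neg using 1; ext r; simp, by linarith [h2.2]⟩

/-- The derivative of t ↦ ∫ f dρ(t) is at most L|ρ'|, and |ρ'|² ≤ -2φ'. Young's inequality 2v ≤ δ +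
v²/δ, integrated in time, replaces Cauchy–Schwarz; δ is optimised later. -/
lemma abs_integral_sub_le_of_maximalSlope {G : P2 d → ℝ≥0∞} {ρ : ℝ → P2 d} (hρ : IsACCurve ρ)
    {φ : ℝ → ℝ} (hφ : AntitoneOn φ (Ici 0))
    (hder : ∀ᵐ t ∂(volume.restrict (Ici (0 : ℝ))), ∃ v : ℝ, HasMetricDerivAt ρ v t ∧ G (ρ t) ≠ ⊤ ∧
        HasDerivAt φ (-(1 / 2) * v ^ 2 - (1 / 2) * (G (ρ t)).toReal ^ 2) t)
    {f : Rd d → ℝ} {L : NNReal} (hf : LipschitzWith L f)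
    (hb : ∃ C : ℝ, ∀ x y, dist (f x) (f y) ≤ C) {s t δ : ℝ} (hs : 0 ≤ s) (hst : s ≤ t)
    (hδ : 0 < δ) :
    |∫ x, f x ∂((ρ t).1 : Measure (Rd d)) - ∫ x, f x ∂((ρ s).1 : Measure (Rd d))| ≤
      L / 2 * (δ * (t - s) + 2 * (φ s - φ t) / δ) := by
  obtain ⟨hint, hle⟩ := AntitoneOn.sub_le_integral_deriv hst
    (hφ.mono fun r hr => hs.trans hr.1)
  rw [← (hρ.absolutelyContinuousOnInterval hf hb hs hst).integral_deriv_eq_sub]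
  have h1 : ∀ᵐ r, r ∈ Ioc s t → ‖deriv (fun r => ∫ x, f x ∂((ρ r).1 : Measure (Rd d))) r‖ ≤
      L / 2 * (δ + -2 / δ * deriv φ r) := by
    rw [ae_restrict_iff' measurableSet_Ici] at hder
    filter_upwards [hder] with r hr hrs
    obtain ⟨v, hv, -, hd⟩ := hr (hs.trans hrs.1.le)
    refine (hv.abs_deriv_le hf hb).trans ?_
    rw [hd.deriv, div_mul_eq_mul_div, mul_div_assoc]
    gcongr
    have h2 : δ + -2 / δ * (-(1 / 2) * v ^ 2 - 1 / 2 * (G (ρ r)).toReal ^ 2) - 2 * v =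
        ((δ - v) ^ 2 + (G (ρ r)).toReal ^ 2) / δ := by
      field_simp
      ring
    have h3 : 0 ≤ ((δ - v) ^ 2 + (G (ρ r)).toReal ^ 2) / δ := by positivity
    linarith
  have hci : IntervalIntegrable (fun _ : ℝ => δ) volume s t := intervalIntegrable_const
  have h2 := intervalIntegral.norm_integral_le_of_norm_le hst h1
    ((hci.add (hint.const_mul _)).const_mul _)
  refine h2.trans ?_
  rw [intervalIntegral.integral_const_mul, intervalIntegral.integral_add hci (hint.const_mul _),
    intervalIntegral.integral_const_mul, intervalIntegral.integral_const, smul_eq_mul,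
    mul_comm (t - s)]
  gcongr
  rw [div_mul_eq_mul_div]
  exact div_le_div_of_nonneg_right (by linarith) hδ.le

/-- On an interval of length one, -φ' is somewhere at most its mean, hence at most the drop of φ,
and G² ≤ -2φ'. The time can be taken outside the null set where the almost-everywhere conditions
fail. -/
lemma exists_time_of_maximalSlope {E : P2 d → EReal} {G : P2 d → ℝ≥0∞} {ρ : ℝ → P2 d}
    {φ : ℝ → ℝ} (hφ : AntitoneOn φ (Ici 0))
    (hE : ∀ᵐ t ∂(volume.restrict (Ici (0 : ℝ))), E (ρ t) = (φ t : EReal))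
    (hder : ∀ᵐ t ∂(volume.restrict (Ici (0 : ℝ))), ∃ v : ℝ, HasMetricDerivAt ρ v t ∧ G (ρ t) ≠ ⊤ ∧
        HasDerivAt φ (-(1 / 2) * v ^ 2 - (1 / 2) * (G (ρ t)).toReal ^ 2) t)
    {s : ℝ} (hs : 0 ≤ s) :
    ∃ t ∈ Icc s (s + 1), E (ρ t) = (φ t : EReal) ∧
      G (ρ t) ≤ ENNReal.ofReal (Real.sqrt (2 * (φ s - φ (s + 1)))) := by
  have hst : s ≤ s + 1 := by linarith
  obtain ⟨hint, hle⟩ := AntitoneOn.sub_le_integral_deriv hst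
    (hφ.mono fun r hr => hs.trans hr.1)
  have hprob : IsProbabilityMeasure (volume.restrict (Ioc s (s + 1))) := ⟨by simp⟩
  have hsub : Ioc s (s + 1) ⊆ Ici 0 := fun r hr => hs.trans hr.1.le
  have hae : ∀ᵐ t ∂(volume.restrict (Ioc s (s + 1))), t ∈ Ioc s (s + 1) ∧
      E (ρ t) = (φ t : EReal) ∧ ∃ v : ℝ, HasMetricDerivAt ρ v t ∧ G (ρ t) ≠ ⊤ ∧
        HasDerivAt φ (-(1 / 2) * v ^ 2 - (1 / 2) * (G (ρ t)).toReal ^ 2) t := by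
    filter_upwards [ae_restrict_mem measurableSet_Ioc, ae_restrict_of_ae_restrict_of_subset hsub hE,
      ae_restrict_of_ae_restrict_of_subset hsub hder] with t h1 h2 h3
    exact ⟨h1, h2, h3⟩
  have hint' : Integrable (fun r => -deriv φ r) (volume.restrict (Ioc s (s + 1))) :=
    ((intervalIntegrable_iff_integrableOn_Ioc_of_le hst).1 hint).neg
  obtain ⟨t, htN, ht⟩ := exists_notMem_null_le_integral hint' (ae_iff.1 hae)
  obtain ⟨hmem, hEt, v, -, hG, hd⟩ := not_not.1 htN
  refine ⟨t, Ioc_subset_Icc_self hmem, hEt, ?_⟩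
  rw [hd.deriv, integral_neg, ← intervalIntegral.integral_of_le hst] at ht
  rw [← ENNReal.ofReal_toReal hG]
  refine ENNReal.ofReal_le_ofReal (Real.le_sqrt_of_sq_le ?_)
  nlinarith [sq_nonneg v]

lemma AntitoneOn.tendsto_sub_shift {φ : ℝ → ℝ} (hφ : AntitoneOn φ (Ici 0)) {c : ℝ}
    (hc : ∀ s, 0 ≤ s → c ≤ φ s) : Tendsto (fun s => φ s - φ (s + 1)) atTop (𝓝 0) := by
  -- Freezing φ at its value at 0 for negative times makes it antitone on all of ℝ.
  have ha : Antitone fun s => φ (max s 0) := fun a b hab =>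
    hφ (mem_Ici.2 (le_max_right _ _)) (mem_Ici.2 (le_max_right _ _)) (max_le_max_right 0 hab)
  have h1 := tendsto_atTop_ciInf ha ⟨c, by rintro _ ⟨s, rfl⟩; exact hc _ (le_max_right _ _)⟩
  have h2 : Tendsto φ atTop (𝓝 (⨅ s, φ (max s 0))) := by
    refine h1.congr' ?_
    filter_upwards [eventually_ge_atTop 0] with s hs
    rw [max_eq_left hs]
  simpa using h2.sub (h2.comp (tendsto_atTop_add_const_right _ 1 tendsto_id))

theorem tendsto_rhoInf_of_isCurveOfMaximalSlope {ρ : ℝ → P2 d}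
    (h : IsCurveOfMaximalSlope EFP GFP ρ) :
    Tendsto (fun t : ℝ => (ρ t).1) atTop (𝓝 (rhoInf d)) := by
  obtain ⟨hρ, φ, hφ, hE, hder⟩ := h
  have hT : ∀ s : ℝ, ∃ t, 0 ≤ s → t ∈ Icc s (s + 1) ∧ EFP (ρ t) = (φ t : EReal) ∧
      GFP (ρ t) ≤ ENNReal.ofReal (Real.sqrt (2 * (φ s - φ (s + 1)))) := by
    intro s
    by_cases hs : 0 ≤ s
    · obtain ⟨t, ht⟩ := exists_time_of_maximalSlope hφ hE hder hs
      exact ⟨t, fun _ => ht⟩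
    · exact ⟨0, fun h => absurd h hs⟩
  choose T hT using hT
  -- φ equals the energy only almost everywhere, so the lower bound is read off at the good time
  -- T(s) ≥ s and carried back by monotonicity.
  have hlow : ∀ s, 0 ≤ s → -(invWeightMeasure d univ).toReal ≤ φ s := by
    intro s hs
    obtain ⟨h1, h2, -⟩ := hT s hs
    have h3 := neg_invWeightMeasure_le_EFPext (ρ (T s)).1
    rw [EFPext_eq_EFP, h2, EReal.coe_le_coe_iff] at h3
    exact h3.trans (hφ hs (hs.trans h1.1) h1.1)
  have hψ := hφ.tendsto_sub_shift hlow
  have hsqrt : Tendsto (fun s => Real.sqrt (2 * (φ s - φ (s + 1)))) atTop (𝓝 0) := by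
    simpa using (hψ.const_mul 2).sqrt
  have hν : Tendsto (fun s => (ρ (T s)).1) atTop (𝓝 (rhoInf d)) := by
    refine tendsto_rhoInf_of_GFPext_tendsto_zero (C := φ 0) ?_ ?_
    · filter_upwards [eventually_ge_atTop 0] with s hs
      obtain ⟨h1, h2, -⟩ := hT s hs
      rw [EFPext_eq_EFP, h2, EReal.coe_le_coe_iff]
      exact hφ (mem_Ici.2 le_rfl) (hs.trans h1.1) (hs.trans h1.1)
    · have h1 : Tendsto (fun s => ENNReal.ofReal (Real.sqrt (2 * (φ s - φ (s + 1))))) atTop (𝓝 0) := by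
        simpa using ENNReal.tendsto_ofReal hsqrt
      refine tendsto_of_tendsto_of_tendsto_of_le_of_le' tendsto_const_nhds h1
        (Eventually.of_forall fun _ => zero_le) ?_
      filter_upwards [eventually_ge_atTop 0] with s hs
      exact (hT s hs).2.2
  rw [tendsto_iff_forall_lipschitz_integral_tendsto] at hν ⊢
  intro f hb hL
  have hlim := hν f hb hL
  obtain ⟨L, hf⟩ := hL
  -- The square root of twice the drop balances the two terms of the Young estimate; the exponential
  -- keeps δ positive when the drop is zero and still tends to 0.
  set δ : ℝ → ℝ := fun s => Real.sqrt (2 * (φ s - φ (s + 1))) + Real.exp (-s) with hδ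
  have hδ0 : Tendsto (fun s => (L : ℝ) * δ s) atTop (𝓝 0) := by
    have := (hsqrt.add Real.tendsto_exp_neg_atTop_nhds_zero).const_mul (L : ℝ)
    rwa [add_zero, mul_zero] at this
  have hdiff : Tendsto (fun s => ∫ x, f x ∂((ρ (T s)).1 : Measure (Rd d)) -
      ∫ x, f x ∂((ρ s).1 : Measure (Rd d))) atTop (𝓝 0) := by
    refine squeeze_zero_norm' ?_ hδ0
    filter_upwards [eventually_ge_atTop 0] with s hs
    obtain ⟨h1, -, -⟩ := hT s hs
    have hδpos : 0 < δ s := add_pos_of_nonneg_of_pos (Real.sqrt_nonneg _) (Real.exp_pos _)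
    have h2 : φ (s + 1) ≤ φ (T s) := hφ (hs.trans h1.1) (show (0 : ℝ) ≤ s + 1 by linarith) h1.2
    have h3 : φ (s + 1) ≤ φ s := hφ hs (show (0 : ℝ) ≤ s + 1 by linarith) (by linarith)
    refine (abs_integral_sub_le_of_maximalSlope hρ hφ hder hf hb hs h1.1 hδpos).trans ?_
    have h4 : 2 * (φ s - φ (T s)) / δ s ≤ δ s := by
      rw [div_le_iff₀ hδpos]
      have h5 := Real.sq_sqrt (show 0 ≤ 2 * (φ s - φ (s + 1)) by linarith)
      have h6 : Real.sqrt (2 * (φ s - φ (s + 1))) ≤ δ s :=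
        le_add_of_nonneg_right (Real.exp_pos _).le
      nlinarith [Real.sqrt_nonneg (2 * (φ s - φ (s + 1)))]
    have h7 : δ s * (T s - s) ≤ δ s := by nlinarith [h1.2]
    rw [div_mul_eq_mul_div, mul_div_assoc]
    gcongr
    linarith
  simpa using hlim.sub hdiff

theorem mainTheorem6 (d : ℕ) (hd : 1 ≤ d) :
    -- the extended functionals on `𝒫(ℝᵈ)` extend `E_FP` and `G_FP`
    (∀ μ : P2 d, EFPext μ.1 = EFP μ ∧ GFPext μ.1 = GFP μ) ∧
    -- convergence of every curve of maximal slope whose initial datum has finite energy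
    (∀ ρ : ℝ → P2 d, EFP (ρ 0) < ⊤ → IsCurveOfMaximalSlope EFP GFP ρ →
      Tendsto (fun t : ℝ => levyProkhorovDist ((ρ t).1 : Measure (Rd d))
        (rhoInf d : Measure (Rd d))) atTop (𝓝 0) ∧
      Tendsto (fun t : ℝ => (ρ t).1) atTop (𝓝 (rhoInf d))) ∧
    -- the limit is the unique weak stationary state
    (∀ μ : PAll d, IsWeakStationaryState EFPext GFPext μ ↔ μ = rhoInf d) ∧
    -- the second moment of the limit is infinite exactly in dimensions one and two
    (secondMoment (rhoInf d) = ⊤ ↔ d ≤ 2) := by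
  refine ⟨fun μ => ⟨EFPext_eq_EFP μ, rfl⟩, fun ρ _ h => ?_, fun μ => ⟨fun h => ?_, ?_⟩,
    secondMoment_rhoInf d hd⟩
  · have hlim := tendsto_rhoInf_of_isCurveOfMaximalSlope h
    refine ⟨?_, hlim⟩
    -- The Lévy–Prokhorov metric induces the narrow topology on ℝᵈ.
    have h1 := tendsto_iff_dist_tendsto_zero.1
      (((LevyProkhorov.probabilityMeasureHomeomorph (Ω := Rd d)).continuous.tendsto _).comp hlim)
    exact h1
  · exact eq_rhoInf_of_GFPext_eq_zero μ h.2
  · rintro rfl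
    exact isWeakStationaryState_rhoInf d
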